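/- Let $\Bbbk$ be an algebraically closed field of characteristic zero. Let $\mathcal F$ be the field of rational functions over $\Bbbk$ in the six variables $x_1,x_2,z_1,z_2,z_{\bar 1},z_{\bar 2}$, and let $c=s_1s_2$ be the Coxeter element of the Weyl group of type $A_1^{(1)}$ (Cartan matrix $\begin{pmatrix}2&-2\\-2&2\end{pmatrix}$). Let $\mathcal A_{dp}(c)\subset\mathcal F$ be the cluster algebra of geometric type with doubled principal coefficients, whose initial seed has mutable variables $x_{\omega_1;c}=x_1,\ x_{\omega_2;c}=x_2$, frozen variables $z_1,z_2,z_{\bar 1},z_{\bar 2}$, and $6\times 2$ extended exchange matrix obtained by stacking $B_c=\begin{pmatrix}0&2\\-2&0\end{pmatrix}$ and two copies of the $2\times2$ identity matrix (the rows being ordered as $x_1,x_2,z_1,z_2,z_{\bar 1},z_{\bar 2}$). Frozen variables are inverted: with the ground ring $R=\Bbbk[z_1^{\pm1},z_2^{\pm1},z_{\bar 1}^{\pm1},z_{\bar 2}^{\pm1}]$, the algebra $\mathcal A_{dp}(c)$ is the $R$-subalgebra of $\mathcal F$ generated by all cluster variables. A cluster monomial is a product of (non-frozen) cluster variables, with non-negative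 integer exponents, all belonging to one cluster; $1$ is a cluster monomial. For $n\ge1$ and $\mathbf a=(a_1,\dots,a_n)\in(\Bbbk^\times)^n$ put $$x^{\mathbf a}_{n\omega^\circ;c}:=x_1^{-n}x_2^{-n}\sum_{0\le k\le m\le n} d_{\mathbf a}(m,k)\,z_{\bar 1}^{m}z_1^{m}z_{\bar 2}^{m-k}z_2^{m-k}x_1^{2(m-k)}x_2^{2(n-m)},$$ $$d_{\mathbf a}(m,k)=\sum_{r=0}^{m}\binom{m-r}{k}\binom{n-2r}{m-r}S_{\mathbf a,r},\qquad S_{\mathbf a,r}=\sum_{\substack{I,J\subseteq\{1,\dots,n\}\\ |I|=|J|=r,\ I\cap J=\varnothing}}\frac{\prod_{i\in I}a_i}{\prod_{j\in J}a_j},$$ where terms with $2r>n$ are zero, since then $S_{\mathbf a,r}=0$. **Theorem.** Choose, for each $n\ge1$, an arbitrary point $\mathbf a=\mathbf a^{(n)}\in(\Bbbk^\times)^n$. Then the elements $x^{\mathbf a^{(n)}}_{n\omega^\circ;c}$ $(n\ge1)$ lie in $\mathcal A_{dp}(c)$, are pairwise distinct and are not cluster monomials, and together with all cluster monomials they form a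 basis of $\mathcal A_{dp}(c)$ as a module over the ground ring $R$. -/

import Mathlib

namespace ClusterBasis

/-- A labeled seed of geometric type in a field `F`, with mutable indices `I` and frozen
indices `J`: the extended cluster and the extended exchange matrix. -/
structure Seed (I J F : Type*) where
  var : I ⊕ J → F
  mat : Matrix (I ⊕ J) I ℤ

section Matrices

variable {I J : Type*} [DecidableEq I] [DecidableEq J]

/-- Matrix mutation in direction `k`; the correction term equals `sgn(b_ik) * max(b_ik * b_kj, 0)`. -/
def mutateMatrix (k : I) (B : Matrix (I ⊕ J) I ℤ) : Matrix (I ⊕ J) I ℤ :=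
  Matrix.of fun i j =>
    if i = Sum.inl k ∨ j = k then - B i j
    else B i j + (max (B i k) 0 * max (B (Sum.inl k) j) 0
      - max (-B i k) 0 * max (-B (Sum.inl k) j) 0)

end Matrices

namespace Seed

variable {I J F : Type*} [Fintype I] [Fintype J] [DecidableEq I] [DecidableEq J] [Field F]

/-- Seed mutation in direction `k`; only the `k`-th mutable variable changes, by the exchange
relation `x_k * x_k' = ∏ y_i ^ [b_ik]_+ + ∏ y_i ^ [-b_ik]_+`, where `y` is the extended cluster. -/
noncomputable def mutate (k : I) (s : Seed I J F) : Seed I J F where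
  var := Function.update s.var (Sum.inl k)
    ((∏ i, s.var i ^ (s.mat i k).toNat + ∏ i, s.var i ^ (-s.mat i k).toNat) / s.var (Sum.inl k))
  mat := mutateMatrix k s.mat

/-- `s.MutationEquiv t`: the seed `t` is obtained from `s` by a finite sequence of mutations. -/
def MutationEquiv (s t : Seed I J F) : Prop :=
  Relation.ReflTransGen (fun u v : Seed I J F => ∃ k : I, v = u.mutate k) s t

/-- The cluster variables (frozen variables not included). -/
def clusterVariables (s : Seed I J F) : Set F :=
  {f | ∃ t : Seed I J F, s.MutationEquiv t ∧ ∃ i : I, f = t.var (Sum.inl i)}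

/-- The cluster monomials: products of (non-frozen) cluster variables of a single cluster. -/
def clusterMonomials (s : Seed I J F) : Set F :=
  {f | ∃ t : Seed I J F, s.MutationEquiv t ∧ ∃ e : I → ℕ, f = ∏ i, t.var (Sum.inl i) ^ e i}

variable (𝕜 : Type*) [Field 𝕜] [Algebra 𝕜 F]

/-- The ground ring `𝕜[z_j^{±1}]`, generated by the frozen variables and their inverses. -/
def groundRing (s : Seed I J F) : Subalgebra 𝕜 F :=
  Algebra.adjoin 𝕜
    (Set.range (fun j : J => s.var (Sum.inr j)) ∪ Set.range (fun j : J => (s.var (Sum.inr j))⁻¹))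

/-- The cluster algebra with invertible frozen variables: the subalgebra over the ground ring
generated by all cluster variables. -/
def clusterAlgebra (s : Seed I J F) : Subalgebra (s.groundRing 𝕜) F :=
  Algebra.adjoin (s.groundRing 𝕜) s.clusterVariables

end Seed

/-- The exchange matrix `B_c` of a Cartan matrix `A` and the Coxeter element `c = s_1 ⋯ s_n`. -/
def coxeterExchangeMatrix {n : ℕ} (A : Matrix (Fin n) (Fin n) ℤ) : Matrix (Fin n) (Fin n) ℤ :=
  Matrix.of fun i j => if i = j then 0 else if j < i then A i j else - A i j

/-- The ambient field: rational functions in `x_i`, `z_i`, `z_{ī}`, `1 ≤ i ≤ n`. -/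
abbrev AmbientField (𝕜 : Type*) [Field 𝕜] (n : ℕ) : Type _ :=
  FractionRing (MvPolynomial (Fin n ⊕ (Fin n ⊕ Fin n)) 𝕜)

/-- The initial seed with doubled principal coefficients: its extended exchange matrix is `B_c` with
two identity matrices below it. -/
noncomputable def dpSeed (𝕜 : Type*) [Field 𝕜] {n : ℕ} (A : Matrix (Fin n) (Fin n) ℤ) :
    Seed (Fin n) (Fin n ⊕ Fin n) (AmbientField 𝕜 n) where
  var := fun v => algebraMap (MvPolynomial (Fin n ⊕ (Fin n ⊕ Fin n)) 𝕜) _ (MvPolynomial.X v)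
  mat := Matrix.fromRows (coxeterExchangeMatrix A) (Matrix.fromRows 1 1)

/-- The Cartan matrix of type `A_1^{(1)}`. -/
def cartanA11 : Matrix (Fin 2) (Fin 2) ℤ := !![2, -2; -2, 2]

/-- The initial seed of `A_dp(c)` in type `A_1^{(1)}`, `c = s_1 s_2`. The nodes `1`, `2` are the
elements `0`, `1` of `Fin 2`. -/
noncomputable abbrev seedA11 (𝕜 : Type*) [Field 𝕜] :
    Seed (Fin 2) (Fin 2 ⊕ Fin 2) (AmbientField 𝕜 2) :=
  dpSeed 𝕜 cartanA11

section Imaginary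

variable {𝕜 : Type*} [Field 𝕜] {n : ℕ}

/-- `S_{a,r} = ∑ (∏_{i ∈ I} a_i) / (∏_{j ∈ J} a_j)` over disjoint `I, J` of cardinality `r`. -/
def sumS (a : Fin n → 𝕜ˣ) (r : ℕ) : 𝕜 :=
  ∑ p ∈ ((Finset.univ : Finset (Fin n)).powersetCard r ×ˢ
      (Finset.univ : Finset (Fin n)).powersetCard r) with Disjoint p.1 p.2,
    (∏ i ∈ p.1, (a i : 𝕜)) / ∏ j ∈ p.2, (a j : 𝕜)

/-- `d_a(m,k) = ∑_{r=0}^m C(m-r,k) C(n-2r,m-r) S_{a,r}`. The truncated subtraction `n - 2 * r` is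
harmless because `S_{a,r} = 0` for `2 * r > n`. -/
def coeffD (a : Fin n → 𝕜ˣ) (m k : ℕ) : 𝕜 :=
  ∑ r ∈ Finset.range (m + 1),
    ((m - r).choose k : 𝕜) * ((n - 2 * r).choose (m - r) : 𝕜) * sumS a r

/-- The element `x^a_{nω°;c}`, as a rational function. -/
noncomputable def imaginaryElement (a : Fin n → 𝕜ˣ) : AmbientField 𝕜 2 :=
  let x₁ := (seedA11 𝕜).var (Sum.inl 0)
  let x₂ := (seedA11 𝕜).var (Sum.inl 1)
  let z₁ := (seedA11 𝕜).var (Sum.inr (Sum.inl 0))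
  let z₂ := (seedA11 𝕜).var (Sum.inr (Sum.inl 1))
  let w₁ := (seedA11 𝕜).var (Sum.inr (Sum.inr 0))
  let w₂ := (seedA11 𝕜).var (Sum.inr (Sum.inr 1))
  (x₁ ^ n)⁻¹ * (x₂ ^ n)⁻¹ *
    ∑ m ∈ Finset.range (n + 1), ∑ k ∈ Finset.range (m + 1),
      algebraMap 𝕜 (AmbientField 𝕜 2) (coeffD a m k) *
        (w₁ ^ m * z₁ ^ m * w₂ ^ (m - k) * z₂ ^ (m - k) *
          x₁ ^ (2 * (m - k)) * x₂ ^ (2 * (n - m)))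

end Imaginary

end ClusterBasis

/-!
Write `u`, `v` for the products of the two copies of each frozen variable, `p = u * v`, and
`z = (x₂² + p x₁² + u) / (x₁ x₂)`. Two elementary facts govern this cluster algebra.

* The cluster variables `X_n` (`n : ℤ`, with clusters `{X_n, X_{n+1}}`) are, up to units of the ground
  ring, the terms of the sequence with `Y_1 = x₁`, `Y_2 = x₂` and `Y_{n+1} = z Y_n - p Y_{n-1}`. The
  exchange relations become the Cassini identity for this linear recurrence
  (`mul_eq_sq_add_of_recurrence`, `exchange_scale_mul`), and the seeds reached by mutation can be
  listed explicitly (`mutationEquiv_chainSeed_iff`).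
* The imaginary element of index `n` equals `∑ r, S_{a,r} p^r z^(n-2r)` (`imaginaryElement_eq`), a
  monic polynomial of degree `n` in `z`. Hence replacing `1, z, z², …` by `1` and the imaginary
  elements is a unitriangular change, whatever the points `a` are.

Spanning: let `M` be the span of the monomials in `Y_k`, `Y_{k+1}` and of the powers of `z`. The
recurrence and the Cassini identity give `z M ⊆ M`; for a monomial `m` in `Y_k`, `Y_{k+1}` the products
`Y_n m` obey the recurrence in `n` and lie in `M` for `n = k, k + 1`, hence for all `n`. So `M` is stable
under the whole algebra (`adjoin_le_standardSpan`).

Independence: order Laurent monomials in `x₁`, `x₂` by total degree, then by degree in `x₂`. The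
part of `Y_n` of highest total degree is the single monomial `x₁^(2-n) x₂^(n-1)`
(`sub_laurentMonomial_mem_span`), and `z` has leading monomial `x₂ / x₁`. Therefore the monomials in
consecutive cluster variables of degree `N ≥ 1` have as leading exponents all pairs `(N, j)`, each
once, and the polynomials of degree `n` in `z` have leading exponent `(0, n)`; all of these are
distinct (`linearIndependent_sumElim_consecutiveMonomial`).
-/

namespace ClusterBasis

/-! ### Triangular families -/

section Triangular

variable {R F : Type*} [CommRing R] [CommRing F] [Algebra R F]

variable {Γ : Type*} {B : Γ → F}

section Lead

variable [PartialOrder Γ]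

variable (R B) in
/-- `HasLead R B γ f`: the element `f` is the sum of the basis monomial `B γ` and an `R`-linear
combination of basis monomials of smaller exponents. -/
def HasLead (γ : Γ) (f : F) : Prop :=
  f - B γ ∈ Submodule.span R (B '' Set.Iio γ)

theorem HasLead.mem_span_Iio {γ δ : Γ} {f : F} (hf : HasLead R B δ f) (h : δ < γ) :
    f ∈ Submodule.span R (B '' Set.Iio γ) := by
  have h2 : B δ ∈ Submodule.span R (B '' Set.Iio γ) := Submodule.subset_span ⟨_, h, rfl⟩
  simpa using add_mem (Submodule.span_mono (Set.image_mono (Set.Iio_subset_Iio h.le)) hf) h2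

end Lead

variable [AddCommMonoid Γ]

theorem mul_mem_span_image (hB : ∀ γ δ, B (γ + δ) = B γ * B δ) {S T U : Set Γ}
    (h : ∀ γ ∈ S, ∀ δ ∈ T, γ + δ ∈ U) {f g : F} (hf : f ∈ Submodule.span R (B '' S))
    (hg : g ∈ Submodule.span R (B '' T)) : f * g ∈ Submodule.span R (B '' U) := by
  have := Submodule.mul_mem_mul hf hg
  rw [Submodule.span_mul_span] at this
  refine Submodule.span_mono ?_ this
  rintro _ ⟨_, ⟨γ, hγ, rfl⟩, _, ⟨δ, hδ, rfl⟩, rfl⟩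
  exact ⟨γ + δ, h γ hγ δ hδ, hB γ δ⟩

variable [PartialOrder Γ]

theorem HasLead.mul [IsOrderedCancelAddMonoid Γ] (hB : ∀ γ δ, B (γ + δ) = B γ * B δ) {γ δ : Γ}
    {f g : F} (hf : HasLead R B γ f) (hg : HasLead R B δ g) : HasLead R B (γ + δ) (f * g) := by
  unfold HasLead at hf hg ⊢
  have hδ : B δ ∈ Submodule.span R (B '' {δ}) := Submodule.subset_span ⟨δ, rfl, rfl⟩
  have hγ : B γ ∈ Submodule.span R (B '' {γ}) := Submodule.subset_span ⟨γ, rfl, rfl⟩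
  have h1 : (f - B γ) * (g - B δ) ∈ Submodule.span R (B '' Set.Iio (γ + δ)) :=
    mul_mem_span_image (S := Set.Iio γ) (T := Set.Iio δ) hB (fun a ha b hb =>
      Set.mem_Iio.2 (add_lt_add (Set.mem_Iio.1 ha) (Set.mem_Iio.1 hb))) hf hg
  have h2 : (f - B γ) * B δ ∈ Submodule.span R (B '' Set.Iio (γ + δ)) :=
    mul_mem_span_image (S := Set.Iio γ) (T := {δ}) hB (fun a ha b hb => by
      rw [Set.mem_singleton_iff.1 hb, Set.mem_Iio]
      exact add_lt_add_left (Set.mem_Iio.1 ha) δ) hf hδ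
  have h3 : B γ * (g - B δ) ∈ Submodule.span R (B '' Set.Iio (γ + δ)) :=
    mul_mem_span_image (S := {γ}) (T := Set.Iio δ) hB (fun a ha b hb => by
      rw [Set.mem_singleton_iff.1 ha, Set.mem_Iio]
      exact add_lt_add_right (Set.mem_Iio.1 hb) γ) hγ hg
  have h4 : f * g - B (γ + δ) = (f - B γ) * (g - B δ) + (f - B γ) * B δ + B γ * (g - B δ) := by
    rw [hB]; ring
  rw [h4]
  exact add_mem (add_mem h1 h2) h3

theorem HasLead.one (hB0 : B 0 = 1) : HasLead R B 0 1 := by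
  simp [HasLead, hB0]

theorem HasLead.pow [IsOrderedCancelAddMonoid Γ] (hB : ∀ γ δ, B (γ + δ) = B γ * B δ)
    (hB0 : B 0 = 1) {γ : Γ} {f : F} (hf : HasLead R B γ f) (n : ℕ) :
    HasLead R B (n • γ) (f ^ n) := by
  induction n with
  | zero => simpa using HasLead.one hB0
  | succ n ih => rw [succ_nsmul, pow_succ]; exact ih.mul hB hf

/-- A family that is triangular, with distinct leading terms, with respect to a linearly ordered
linearly independent family is linearly independent. -/
theorem linearIndependent_of_triangular {ι Γ : Type*} [LinearOrder Γ] {B : Γ → F}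
    (hB : LinearIndependent R B) {g : ι → Γ} (hg : Function.Injective g) {f : ι → F}
    (hf : ∀ i, HasLead R B (g i) (f i)) : LinearIndependent R f := by
  classical
  rw [linearIndependent_iff']
  intro s
  induction s using Finset.induction_on_max_value (f := g) with
  | empty => simp
  | insert a s has hmax ih =>
    intro c hc
    rw [Finset.sum_insert has] at hc
    have hlow : ∀ i ∈ s, f i ∈ Submodule.span R (B '' Set.Iio (g a)) := by
      intro i hi
      have hlt : g i < g a :=
        lt_of_le_of_ne (hmax i hi) fun h => has (hg h ▸ hi)
      exact (hf i).mem_span_Iio hlt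
    have hca : c a = 0 := by
      refine hB.eq_zero_of_smul_mem_span (g a) (c a) ?_
      refine Submodule.span_mono (s := B '' Set.Iio (g a)) ?_ ?_
      · refine Set.image_mono fun x hx => ?_
        simpa using (ne_of_lt hx)
      · have h3 : c a • B (g a) = -(c a • (f a - B (g a))) - ∑ i ∈ s, c i • f i := by
          rw [smul_sub]
          linear_combination (exp := 1) hc
        rw [h3]
        exact sub_mem (neg_mem (Submodule.smul_mem _ _ (hf a)))
          (Submodule.sum_mem _ fun i hi => Submodule.smul_mem _ _ (hlow i hi))
    intro i hi
    rw [hca, zero_smul, zero_add] at hc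
    rcases Finset.mem_insert.1 hi with rfl | hi
    · exact hca
    · exact ih c hc i hi

end Triangular

/-! ### Laurent monomials in algebraically independent elements -/

section Laurent

/-- Laurent monomials in finitely many algebraically independent elements of a field are linearly
independent. -/
theorem linearIndependent_laurent_monomials {K F ι : Type*} [CommRing K] [Field F]
    [Algebra K F] [Fintype ι] {x : ι → F} (hx : AlgebraicIndependent K x) (hx0 : ∀ i, x i ≠ 0) :
    LinearIndependent K fun e : ι → ℤ => ∏ i, x i ^ e i := by
  have hnat : LinearIndependent K fun e : ι →₀ ℕ => ∏ i, x i ^ e i := by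
    have h := (MvPolynomial.basisMonomials ι K).linearIndependent.map'
      (MvPolynomial.aeval x).toLinearMap (LinearMap.ker_eq_bot.2 hx)
    have h1 : (MvPolynomial.aeval x).toLinearMap ∘ MvPolynomial.basisMonomials ι K =
        fun e : ι →₀ ℕ => ∏ i, x i ^ e i := by
      ext e
      simp [MvPolynomial.aeval_monomial, Finsupp.prod_fintype]
    rw [← h1]
    exact h
  rw [linearIndependent_iff_finset_linearIndependent]
  intro s
  -- all exponents in the finite set `s` become non-negative after a shift by `N`
  obtain ⟨N, hN⟩ : ∃ N : ℕ, ∀ e ∈ s, ∀ i, 0 ≤ e i + N := by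
    refine ⟨∑ e ∈ s, ∑ i, (e i).natAbs, fun e he i => ?_⟩
    have h1 : (e i).natAbs ≤ ∑ i, (e i).natAbs :=
      Finset.single_le_sum (f := fun i => (e i).natAbs) (fun _ _ => Nat.zero_le _)
        (Finset.mem_univ i)
    have h2 : ∑ i, (e i).natAbs ≤ ∑ e ∈ s, ∑ i, (e i).natAbs :=
      Finset.single_le_sum (f := fun e : ι → ℤ => ∑ i, (e i).natAbs) (fun _ _ => Nat.zero_le _) he
    omega
  refine LinearIndependent.of_comp (LinearMap.mulRight K (∏ i, x i ^ N)) ?_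
  have hinj : Function.Injective fun e : s =>
      (Finsupp.equivFunOnFinite.symm fun i => (e.1 i + N).toNat : ι →₀ ℕ) := by
    intro e e' h
    ext i
    have h1 := DFunLike.congr_fun h i
    have h2 := hN e.1 e.2 i
    have h3 := hN e'.1 e'.2 i
    simp only [Finsupp.equivFunOnFinite_symm_apply_apply] at h1
    omega
  have h1 : (LinearMap.mulRight K (∏ i, x i ^ N) ∘ fun e : s => ∏ i, x i ^ e.1 i) =
      fun e : s => ∏ i, x i ^ (e.1 i + N).toNat := by
    ext e
    simp only [Function.comp_apply, LinearMap.mulRight_apply, ← Finset.prod_mul_distrib]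
    refine Finset.prod_congr rfl fun i _ => ?_
    rw [← zpow_natCast, ← zpow_natCast, Int.toNat_of_nonneg (hN e.1 e.2 i), zpow_add₀ (hx0 i)]
  have h2 := hnat.comp _ hinj
  simp only [Function.comp_def, Finsupp.equivFunOnFinite_symm_apply_apply] at h2
  rw [← h1] at h2
  exact h2

open scoped IntermediateField.algebraAdjoinAdjoin in
/-- If `x`, `z` are jointly algebraically independent, the Laurent monomials in the `x` are linearly
independent over every ring of rational functions in the `z`. -/
theorem linearIndependent_laurent_monomials_of_le {𝕜 F ι J : Type*} [Field 𝕜] [Field F]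
    [Algebra 𝕜 F] [Fintype ι] {x : ι → F} {z : J → F}
    (h : AlgebraicIndependent 𝕜 (Sum.elim x z)) {R : Subalgebra 𝕜 F}
    (hR : R ≤ (IntermediateField.adjoin 𝕜 (Set.range z)).toSubalgebra) :
    LinearIndependent R fun e : ι → ℤ => ∏ i, x i ^ e i := by
  have h1 := (AlgebraicIndependent.sumElim_iff.1 h).2
  have hx0 : ∀ i, x i ≠ 0 := fun i => h.ne_zero (Sum.inl i)
  have h2 := linearIndependent_laurent_monomials h1 hx0
  have h3 := (LinearIndependent.iff_fractionRing (Algebra.adjoin 𝕜 (Set.range z))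
    (IntermediateField.adjoin 𝕜 (Set.range z))).1 h2
  rw [linearIndependent_iff'] at h3 ⊢
  intro s c hc i hi
  have h4 := h3 s (fun i => ⟨c i, hR (c i).2⟩) hc i hi
  have h5 : (c i : F) = 0 := congrArg (fun y => algebraMap _ F y) h4
  exact Subtype.ext h5

end Laurent

/-! ### Two-sided sequences with a three-term recurrence -/

section Recurrence

/-- A second-order linear recurrence with invertible last coefficient has a solution indexed by
all integers. -/
theorem exists_recurrent_sequence {F : Type*} [Field F] (z p a b : F) (hp : p ≠ 0) :
    ∃ Y : ℤ → F, Y 1 = a ∧ Y 2 = b ∧ ∀ n, Y (n + 1) = z * Y n - p * Y (n - 1) := by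
  let σ : Equiv.Perm (F × F) :=
    { toFun := fun q => (q.2, z * q.2 - p * q.1)
      invFun := fun q => ((z * q.1 - q.2) / p, q.1)
      left_inv := fun q => by ext <;> simp [hp]
      right_inv := fun q => by ext <;> simp [mul_div_cancel₀, hp] }
  have h1 : ∀ n : ℤ, (σ ^ (n + 1)) (a, b) = σ ((σ ^ n) (a, b)) := fun n => by
    rw [add_comm, zpow_one_add, Equiv.Perm.mul_apply]
  have h2 : ∀ n : ℤ, ((σ ^ n) (a, b)).2 = ((σ ^ (n + 1)) (a, b)).1 := fun n => by rw [h1]; rfl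
  refine ⟨fun n => ((σ ^ (n - 1)) (a, b)).1, by simp, ?_, fun n => ?_⟩
  · change ((σ ^ (1 : ℤ)) (a, b)).1 = b
    rw [zpow_one]; rfl
  · have h3 : n + 1 - 1 = n - 1 - 1 + 1 + 1 := by ring
    have h4 : n - 1 = n - 1 - 1 + 1 := by ring
    have h5 := congrArg Prod.snd (h1 (n - 1 - 1))
    rw [h2] at h5
    simp only
    rw [h3, h5]
    change z * ((σ ^ (n - 1 - 1)) (a, b)).2 - p * ((σ ^ (n - 1 - 1)) (a, b)).1 = _
    rw [h2, ← h4]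

/-- The Cassini identity: the determinant of consecutive terms of a second-order linear recurrence
is a geometric progression. -/
theorem mul_eq_sq_add_of_recurrence {F : Type*} [Field F] {z p : F} (hp : p ≠ 0) {Y : ℤ → F}
    (hY : ∀ n, Y (n + 1) = z * Y n - p * Y (n - 1)) {c : F}
    (h1 : Y 2 * Y 0 = Y 1 ^ 2 + c) (n : ℤ) :
    Y (n + 1) * Y (n - 1) = Y n ^ 2 + c * p ^ (n - 1) := by
  have hstep : ∀ m : ℤ, Y (m + 1 + 1) * Y m - Y (m + 1) ^ 2 =
      p * (Y (m + 1) * Y (m - 1) - Y m ^ 2) := fun m => by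
    have h := hY (m + 1)
    rw [add_sub_cancel_right] at h
    rw [h]
    linear_combination (-Y (m + 1)) * hY m
  induction n using Int.inductionOn' (b := 1) with
  | zero => simpa using h1
  | succ k _ ih =>
    have h2 := hstep k
    rw [add_sub_cancel_right, show k = k - 1 + 1 by ring, zpow_add_one₀ hp, ← sub_eq_iff_eq_add']
    rw [show k - 1 + 1 = k by ring, h2, ih]
    ring
  | pred k _ ih =>
    have h2 := hstep (k - 1)
    rw [show k = k - 1 + 1 by ring, add_sub_cancel_right] at ih
    rw [ih] at h2
    rw [show k - 1 = k - 1 - 1 + 1 by ring, zpow_add_one₀ hp] at h2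
    apply mul_left_cancel₀ hp
    rw [show k - 1 - 1 + 1 = k - 1 by ring] at h2
    linear_combination -h2

end Recurrence

/-! ### Leading monomials and linear independence -/

section Leading

variable {R F : Type*} [CommRing R] [Field F] [Algebra R F]

/-- The Laurent monomials in `x₁`, `x₂`, indexed so that the first exponent is the total degree and
the second one the degree in `x₂`; the index set is ordered lexicographically. -/
def laurentMonomial (x₁ x₂ : F) (γ : ℤ ×ₗ ℤ) : F :=
  x₁ ^ ((ofLex γ).1 - (ofLex γ).2) * x₂ ^ (ofLex γ).2

variable {x₁ x₂ : F}

theorem laurentMonomial_zero : laurentMonomial x₁ x₂ 0 = 1 := by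
  simp [laurentMonomial]

theorem laurentMonomial_add (h₁ : x₁ ≠ 0) (h₂ : x₂ ≠ 0) (γ δ : ℤ ×ₗ ℤ) :
    laurentMonomial x₁ x₂ (γ + δ) = laurentMonomial x₁ x₂ γ * laurentMonomial x₁ x₂ δ := by
  simp only [laurentMonomial, ofLex_add, Prod.fst_add, Prod.snd_add]
  rw [add_sub_add_comm, zpow_add₀ h₁, zpow_add₀ h₂]
  ring

theorem linearIndependent_laurentMonomial
    (h : LinearIndependent R fun e : Fin 2 → ℤ => ∏ i, ![x₁, x₂] i ^ e i) :
    LinearIndependent R (laurentMonomial x₁ x₂) := by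
  have h1 : laurentMonomial x₁ x₂ = (fun e : Fin 2 → ℤ => ∏ i, ![x₁, x₂] i ^ e i) ∘
      fun γ : ℤ ×ₗ ℤ => ![(ofLex γ).1 - (ofLex γ).2, (ofLex γ).2] := by
    ext γ
    simp [laurentMonomial, Fin.prod_univ_two]
  rw [h1]
  refine h.comp _ fun γ δ hγδ => ?_
  have h2 := congrFun hγδ 0
  have h3 := congrFun hγδ 1
  simp at h2 h3
  apply ofLex.injective
  ext <;> omega

/-- Up to terms of lower total degree, the terms of the sequence with initial values `x₁`, `x₂` are
single Laurent monomials. Unlike the lexicographic leading term, this statement propagates along the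
recurrence in both directions. -/
theorem sub_laurentMonomial_mem_span (h₁ : x₁ ≠ 0) (h₂ : x₂ ≠ 0) {z : F} (p : Rˣ) (q : R)
    (hz : z = laurentMonomial x₁ x₂ (toLex (0, 1)) +
      (p : R) • laurentMonomial x₁ x₂ (toLex (0, -1)) +
      q • laurentMonomial x₁ x₂ (toLex (-2, -1)))
    {Y : ℤ → F} (hY1 : Y 1 = x₁) (hY2 : Y 2 = x₂)
    (hY : ∀ n, Y (n + 1) = z * Y n - (p : R) • Y (n - 1)) (n : ℤ) :
    Y n - laurentMonomial x₁ x₂ (toLex (1, n - 1)) ∈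
      Submodule.span R (laurentMonomial x₁ x₂ '' {δ | (ofLex δ).1 < 1}) := by
  set B := laurentMonomial x₁ x₂ with hBdef
  have hadd : ∀ γ δ, B (γ + δ) = B γ * B δ := laurentMonomial_add h₁ h₂
  set L := Submodule.span R (B '' {δ | (ofLex δ).1 < 1}) with hL
  have hz0 : z ∈ Submodule.span R (B '' {δ | (ofLex δ).1 ≤ 0}) := by
    rw [hz]
    refine add_mem (add_mem ?_ (Submodule.smul_mem _ _ ?_)) (Submodule.smul_mem _ _ ?_) <;>
      exact Submodule.subset_span ⟨_, by simp, rfl⟩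
  have hzL : ∀ e ∈ L, z * e ∈ L := fun e he =>
    mul_mem_span_image (S := {δ | (ofLex δ).1 ≤ 0}) (T := {δ | (ofLex δ).1 < 1}) hadd
      (fun γ hγ δ hδ => by
        simp only [Set.mem_ofPred_eq, ofLex_add, Prod.fst_add] at *
        omega) hz0 he
  have hzB : ∀ m : ℤ, z * B (toLex (1, m)) - B (toLex (1, m + 1)) -
      (p : R) • B (toLex (1, m - 1)) ∈ L := fun m => by
    have e1 : B (toLex (1, m + 1)) = B (toLex (0, 1)) * B (toLex (1, m)) := by
      rw [← hadd]; congr 1; rw [← toLex_add]; simp [add_comm]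
    have e2 : B (toLex (1, m - 1)) = B (toLex (0, -1)) * B (toLex (1, m)) := by
      rw [← hadd]; congr 1; rw [← toLex_add]; simp [sub_eq_add_neg, add_comm]
    have e3 : B (toLex (-1, m - 1)) = B (toLex (-2, -1)) * B (toLex (1, m)) := by
      rw [← hadd]; congr 1; rw [← toLex_add]; simp [sub_eq_add_neg, add_comm]
    have e4 : z * B (toLex (1, m)) - B (toLex (1, m + 1)) - (p : R) • B (toLex (1, m - 1)) =
        q • B (toLex (-1, m - 1)) := by
      rw [e1, e2, e3, hz]; simp only [Algebra.smul_def]; ring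
    rw [e4]
    exact Submodule.smul_mem _ _ (Submodule.subset_span ⟨_, by simp, rfl⟩)
  have key : ∀ n : ℤ, Y n - B (toLex (1, n - 1)) ∈ L ∧
      Y (n + 1) - B (toLex (1, n + 1 - 1)) ∈ L := fun n => by
    induction n using Int.inductionOn' (b := 1) with
    | zero =>
      have e1 : Y (1 + 1) = x₂ := hY2
      rw [hY1, e1]
      constructor <;> simp [hBdef, laurentMonomial]
    | succ k _ ih =>
      refine ⟨ih.2, ?_⟩
      have h := hY (k + 1)
      rw [add_sub_cancel_right] at h
      have h3 : Y (k + 1 + 1) - B (toLex (1, k + 1 + 1 - 1)) =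
          z * (Y (k + 1) - B (toLex (1, k + 1 - 1))) - (p : R) • (Y k - B (toLex (1, k - 1))) +
          (z * B (toLex (1, k)) - B (toLex (1, k + 1)) - (p : R) • B (toLex (1, k - 1))) := by
        rw [h]; simp only [Algebra.smul_def, add_sub_cancel_right]; ring
      rw [h3]
      exact add_mem (sub_mem (hzL _ ih.2) (Submodule.smul_mem _ _ ih.1)) (hzB k)
    | pred k _ ih =>
      rw [sub_add_cancel]
      refine ⟨?_, ih.1⟩
      have h3 : Y (k - 1) - B (toLex (1, k - 1 - 1)) = ((p⁻¹ : Rˣ) : R) •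
          (z * (Y k - B (toLex (1, k - 1))) - (Y (k + 1) - B (toLex (1, k + 1 - 1))) +
          (z * B (toLex (1, k - 1)) - B (toLex (1, k - 1 + 1)) -
            (p : R) • B (toLex (1, k - 1 - 1)))) := by
        have e1 : ∀ w : F, w = ((p⁻¹ : Rˣ) : R) • (p : R) • w := fun w => by
          rw [smul_smul, Units.inv_mul, one_smul]
        rw [e1 (Y (k - 1) - _), hY k, add_sub_cancel_right, sub_add_cancel]
        congr 1
        rw [smul_sub]
        ring
      rw [h3]
      exact Submodule.smul_mem _ _ (add_mem (sub_mem (hzL _ ih.1) ih.2) (hzB _))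
  exact (key n).1

theorem hasLead_of_recurrence (h₁ : x₁ ≠ 0) (h₂ : x₂ ≠ 0) {z : F} (p : Rˣ) (q : R)
    (hz : z = laurentMonomial x₁ x₂ (toLex (0, 1)) +
      (p : R) • laurentMonomial x₁ x₂ (toLex (0, -1)) +
      q • laurentMonomial x₁ x₂ (toLex (-2, -1)))
    {Y : ℤ → F} (hY1 : Y 1 = x₁) (hY2 : Y 2 = x₂)
    (hY : ∀ n, Y (n + 1) = z * Y n - (p : R) • Y (n - 1)) (n : ℤ) :
    HasLead R (laurentMonomial x₁ x₂) (toLex (1, n - 1)) (Y n) :=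
  Submodule.span_mono (Set.image_mono fun _ hδ => Prod.Lex.lt_iff.2 (Or.inl hδ))
    (sub_laurentMonomial_mem_span h₁ h₂ p q hz hY1 hY2 hY n)

/-- The monomials `Y_k ^ a * Y_{k+1} ^ b` of degree `N = a + b ≥ 1` in two consecutive terms of a
sequence, each listed once: they are indexed by `j`, with quotient and remainder of `j` by `N` equal
to `k - 1` and `b`. -/
def consecutiveMonomial (Y : ℤ → F) (q : ℕ+ × ℤ) : F :=
  Y (q.2 / q.1 + 1) ^ ((q.1 : ℤ) - q.2 % q.1).toNat * Y (q.2 / q.1 + 1 + 1) ^ (q.2 % q.1).toNat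

theorem exists_consecutiveMonomial_eq (Y : ℤ → F) (k : ℤ) (a b : ℕ) (h : a + b ≠ 0) :
    ∃ q : ℕ+ × ℤ, consecutiveMonomial Y q = Y k ^ a * Y (k + 1) ^ b := by
  have hpos : 0 < a + b := Nat.pos_of_ne_zero h
  rcases Nat.eq_zero_or_pos a with rfl | ha
  · refine ⟨(⟨0 + b, hpos⟩, k * b), ?_⟩
    have hb : (b : ℤ) ≠ 0 := by omega
    simp [consecutiveMonomial, Int.mul_ediv_cancel _ hb]
  · refine ⟨(⟨a + b, hpos⟩, b + (k - 1) * (a + b : ℕ)), ?_⟩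
    have h1 : ((b : ℤ) + (k - 1) * (a + b : ℕ)) / (a + b : ℕ) = k - 1 := by
      rw [Int.add_mul_ediv_right _ _ (by omega), Int.ediv_eq_zero_of_lt (by omega) (by omega),
        zero_add]
    have h2 : ((b : ℤ) + (k - 1) * (a + b : ℕ)) % (a + b : ℕ) = b := by
      rw [Int.add_mul_emod_self_right, Int.emod_eq_of_lt (by omega) (by omega)]
    simp only [consecutiveMonomial, PNat.mk_coe, h1, h2]
    congr 2 <;> simp

theorem hasLead_consecutiveMonomial (h₁ : x₁ ≠ 0) (h₂ : x₂ ≠ 0) {Y : ℤ → F}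
    (hY : ∀ n, HasLead R (laurentMonomial x₁ x₂) (toLex (1, n - 1)) (Y n)) (q : ℕ+ × ℤ) :
    HasLead R (laurentMonomial x₁ x₂) (toLex ((q.1 : ℤ), q.2)) (consecutiveMonomial Y q) := by
  obtain ⟨N, j⟩ := q
  have hadd := laurentMonomial_add h₁ h₂
  have h := ((hY (j / N + 1)).pow hadd laurentMonomial_zero ((N : ℤ) - j % N).toNat).mul hadd
    ((hY (j / N + 1 + 1)).pow hadd laurentMonomial_zero (j % N).toNat)
  have hN : (0 : ℤ) < N := by exact_mod_cast N.pos
  have hr := Int.emod_nonneg j hN.ne'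
  have hr' := Int.emod_lt_of_pos j hN
  have hd := Int.mul_ediv_add_emod j N
  have e1 : ((((N : ℤ) - j % N).toNat : ℕ) : ℤ) = N - j % N := Int.toNat_of_nonneg (by omega)
  have e2 : (((j % N).toNat : ℕ) : ℤ) = j % N := Int.toNat_of_nonneg hr
  have hsmul : ∀ (m : ℕ) (a b : ℤ), m • toLex (a, b) = toLex (m * a, m * b) := fun m a b => by
    change toLex (m • (a, b)) = _
    simp
  rw [hsmul, hsmul, ← toLex_add, e1, e2] at h
  have e3 : (((N : ℤ), j) : ℤ × ℤ) = ((N - j % N) * 1, (N - j % N) * (j / N + 1 - 1)) +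
      (j % N * 1, j % N * (j / N + 1 + 1 - 1)) := by
    ext
    · simp
    · simp only [Prod.snd_add]
      linear_combination -hd
  rw [e3]
  exact h

theorem linearIndependent_sumElim_consecutiveMonomial (h₁ : x₁ ≠ 0) (h₂ : x₂ ≠ 0)
    (hB : LinearIndependent R (laurentMonomial x₁ x₂)) {Y : ℤ → F}
    (hY : ∀ n, HasLead R (laurentMonomial x₁ x₂) (toLex (1, n - 1)) (Y n)) {P : ℕ → F}
    (hP : ∀ n : ℕ, HasLead R (laurentMonomial x₁ x₂) (toLex (0, (n : ℤ))) (P n)) :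
    LinearIndependent R (Sum.elim P (consecutiveMonomial Y)) := by
  refine linearIndependent_of_triangular hB
    (g := Sum.elim (fun n : ℕ => toLex (0, (n : ℤ))) fun q : ℕ+ × ℤ => toLex ((q.1 : ℤ), q.2)) ?_ ?_
  · rintro (m | ⟨N, i⟩) (n | ⟨N', j⟩) h <;> simp at h ⊢
    · exact h
    · exact absurd h.1.symm (by simp)
    · exact h
  · rintro (n | q)
    · exact hP n
    · exact hasLead_consecutiveMonomial h₁ h₂ hY q

end Leading

/-! ### Straightening -/

section Straightening

variable {R F : Type*} [CommRing R] [CommRing F] [Algebra R F]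

variable (R) in
/-- The span of the monomials in two consecutive terms of `Y` and of the powers of `z`. -/
def standardSpan (Y : ℤ → F) (z : F) : Submodule R F :=
  Submodule.span R ({f | ∃ (k : ℤ) (a b : ℕ), f = Y k ^ a * Y (k + 1) ^ b} ∪
    Set.range fun n : ℕ => z ^ n)

variable {Y : ℤ → F} {z : F} {p : R}

theorem monomial_mem_standardSpan (k : ℤ) (a b : ℕ) :
    Y k ^ a * Y (k + 1) ^ b ∈ standardSpan R Y z :=
  Submodule.subset_span (Or.inl ⟨k, a, b, rfl⟩)

theorem pow_mem_standardSpan (n : ℕ) : z ^ n ∈ standardSpan R Y z :=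
  Submodule.subset_span (Or.inr ⟨n, rfl⟩)

/-- To check that multiplication by `w` preserves the standard span it suffices to multiply the
spanning elements. -/
theorem mul_mem_standardSpan_of {w : F}
    (h1 : ∀ k a b, w * (Y k ^ a * Y (k + 1) ^ b) ∈ standardSpan R Y z)
    (h2 : ∀ n, w * z ^ n ∈ standardSpan R Y z) {f : F} (hf : f ∈ standardSpan R Y z) :
    w * f ∈ standardSpan R Y z := by
  have h : standardSpan R Y z ≤ (standardSpan R Y z).comap (LinearMap.mulLeft R w) := by
    refine Submodule.span_le.2 ?_
    rintro _ (⟨k, a, b, rfl⟩ | ⟨n, rfl⟩)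
    · exact h1 k a b
    · exact h2 n
  exact h hf

/-- The standard span is stable under `z`: the three-term relation turns `z` times a monomial into
monomials in at most three consecutive terms, and the Cassini relation eliminates the product of the
outer two. -/
theorem z_mul_mem_standardSpan (hY : ∀ n, Y (n + 1) = z * Y n - p • Y (n - 1)) {κ : ℤ → R}
    (hκ : ∀ n, Y (n + 1) * Y (n - 1) = Y n ^ 2 + algebraMap R F (κ n)) {f : F}
    (hf : f ∈ standardSpan R Y z) : z * f ∈ standardSpan R Y z := by
  have hz : ∀ n, z * Y n = Y (n + 1) + p • Y (n - 1) := fun n => by rw [hY]; ring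
  have hpow : ∀ k a, z * Y k ^ (a + 1) ∈ standardSpan R Y z := fun k a => by
    have h : z * Y k ^ (a + 1) =
        Y k ^ a * Y (k + 1) ^ 1 + p • (Y (k - 1) ^ 1 * Y (k - 1 + 1) ^ a) := by
      rw [sub_add_cancel, pow_succ', ← mul_assoc, hz]
      simp only [Algebra.smul_def]
      ring
    rw [h]
    exact add_mem (monomial_mem_standardSpan _ _ _)
      (Submodule.smul_mem _ _ (monomial_mem_standardSpan _ _ _))
  refine mul_mem_standardSpan_of (fun k a b => ?_) (fun n => ?_) hf
  · rcases a with _ | a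
    · rcases b with _ | b
      · simpa using pow_mem_standardSpan (R := R) (Y := Y) (z := z) 1
      · simpa using hpow (k + 1) b
    · rcases b with _ | b
      · simpa using hpow k a
      · have h : z * (Y k ^ (a + 1) * Y (k + 1) ^ (b + 1)) = Y k ^ a * Y (k + 1) ^ (b + 2) +
            p • (Y k ^ (a + 2) * Y (k + 1) ^ b + κ k • (Y k ^ a * Y (k + 1) ^ b)) := by
          have h1 : z * (Y k ^ (a + 1) * Y (k + 1) ^ (b + 1)) =
              (z * Y k) * (Y k ^ a * Y (k + 1) ^ (b + 1)) := by ring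
          rw [h1, hz]
          simp only [Algebra.smul_def]
          linear_combination (algebraMap R F p * Y k ^ a * Y (k + 1) ^ b) * hκ k
        rw [h]
        exact add_mem (monomial_mem_standardSpan _ _ _) (Submodule.smul_mem _ _
          (add_mem (monomial_mem_standardSpan _ _ _)
            (Submodule.smul_mem _ _ (monomial_mem_standardSpan _ _ _))))
  · rw [← pow_succ']
    exact pow_mem_standardSpan _

/-- For a fixed monomial `m` in `Y_k`, `Y_{k+1}` the products `Y_n * m` satisfy the same recurrence
in `n`, so that stability under `Y_n` follows from stability under `z`. -/
theorem term_mul_mem_standardSpan {p : Rˣ}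
    (hY : ∀ n, Y (n + 1) = z * Y n - (p : R) • Y (n - 1)) {κ : ℤ → R}
    (hκ : ∀ n, Y (n + 1) * Y (n - 1) = Y n ^ 2 + algebraMap R F (κ n)) (n : ℤ) {f : F}
    (hf : f ∈ standardSpan R Y z) : Y n * f ∈ standardSpan R Y z := by
  have hzM : ∀ {f : F}, f ∈ standardSpan R Y z → z * f ∈ standardSpan R Y z :=
    fun hf => z_mul_mem_standardSpan hY hκ hf
  refine mul_mem_standardSpan_of (fun k a b => ?_) (fun m => ?_) hf
  · have key : ∀ n : ℤ, Y n * (Y k ^ a * Y (k + 1) ^ b) ∈ standardSpan R Y z ∧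
        Y (n + 1) * (Y k ^ a * Y (k + 1) ^ b) ∈ standardSpan R Y z := fun n => by
      induction n using Int.inductionOn' (b := k) with
      | zero =>
        constructor
        · rw [← mul_assoc, ← pow_succ']
          exact monomial_mem_standardSpan _ _ _
        · rw [mul_left_comm, ← pow_succ']
          exact monomial_mem_standardSpan _ _ _
      | succ n _ ih =>
        refine ⟨ih.2, ?_⟩
        rw [hY (n + 1), add_sub_cancel_right, sub_mul, smul_mul_assoc, mul_assoc]
        exact sub_mem (hzM ih.2) (Submodule.smul_mem _ _ ih.1)
      | pred n _ ih =>
        rw [sub_add_cancel]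
        refine ⟨?_, ih.1⟩
        have h : Y (n - 1) * (Y k ^ a * Y (k + 1) ^ b) = ((p⁻¹ : Rˣ) : R) •
            (z * (Y n * (Y k ^ a * Y (k + 1) ^ b)) - Y (n + 1) * (Y k ^ a * Y (k + 1) ^ b)) := by
          rw [hY n, sub_mul, smul_mul_assoc, mul_assoc, sub_sub_cancel, smul_smul, Units.inv_mul,
            one_smul]
        rw [h]
        exact Submodule.smul_mem _ _ (sub_mem (hzM ih.1) ih.2)
    exact (key n).1
  · induction m with
    | zero => simpa using monomial_mem_standardSpan (R := R) (Y := Y) (z := z) n 1 0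
    | succ m ih =>
      rw [pow_succ', mul_left_comm]
      exact hzM ih

/-- An algebra generated by scalar multiples of terms of the sequence lies in the standard span. -/
theorem adjoin_le_standardSpan {p : Rˣ}
    (hY : ∀ n, Y (n + 1) = z * Y n - (p : R) • Y (n - 1)) {κ : ℤ → R}
    (hκ : ∀ n, Y (n + 1) * Y (n - 1) = Y n ^ 2 + algebraMap R F (κ n)) {C : Set F}
    (hC : ∀ f ∈ C, ∃ (r : R) (n : ℤ), f = r • Y n) {f : F} (hf : f ∈ Algebra.adjoin R C) :
    f ∈ standardSpan R Y z := by
  have h : ∀ m ∈ standardSpan R Y z, f * m ∈ standardSpan R Y z := by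
    induction hf using Algebra.adjoin_induction with
    | mem x hx =>
      intro m hm
      obtain ⟨r, n, rfl⟩ := hC x hx
      rw [smul_mul_assoc]
      exact Submodule.smul_mem _ _ (term_mul_mem_standardSpan hY hκ n hm)
    | algebraMap r =>
      intro m hm
      rw [← Algebra.smul_def]
      exact Submodule.smul_mem _ _ hm
    | add x y _ _ hx hy =>
      intro m hm
      rw [add_mul]
      exact add_mem (hx m hm) (hy m hm)
    | mul x y _ _ hx hy =>
      intro m hm
      rw [mul_assoc]
      exact hx _ (hy m hm)
  simpa using h 1 (by simpa using pow_mem_standardSpan (R := R) (Y := Y) (z := z) 0)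

end Straightening

/-! ### The seeds of the mutation class -/

section Seeds

/-- The position in the labeled seed of the cluster variable with index `n`: variables of odd index
occupy the first position, those of even index the second. -/
def position (n : ℤ) : Fin 2 := if Even n then 1 else 0

theorem position_cases (n : ℤ) :
    position n = 0 ∧ position (n + 1) = 1 ∨ position n = 1 ∧ position (n + 1) = 0 := by
  by_cases h : Even n
  · right; simp [position, h]
  · left; simp [position, h]

/-- The `c`-vector of the `n`-th cluster variable in the seed with cluster `X_n`, `X_{n+1}`. -/
def cVecFst (n : ℤ) : Fin 2 → ℤ :=
  if 1 ≤ n then ![n, n - 1] else if n = 0 then ![0, -1] else ![-n - 2, -n - 1]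

/-- The `c`-vector of the `(n+1)`-st cluster variable in the seed with cluster `X_n`, `X_{n+1}`. -/
def cVecSnd (n : ℤ) : Fin 2 → ℤ :=
  if 1 ≤ n then ![1 - n, 2 - n] else if n = 0 then ![1, 0] else ![n + 1, n]

theorem cVecSnd_add_one (n : ℤ) (r : Fin 2) : cVecSnd (n + 1) r = -cVecFst n r := by
  unfold cVecSnd cVecFst
  fin_cases r <;> split_ifs <;> simp <;> omega

theorem cVecFst_add_one (n : ℤ) (r : Fin 2) :
    cVecFst (n + 1) r = cVecSnd n r + max (cVecFst n r) 0 * 2 := by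
  unfold cVecSnd cVecFst
  fin_cases r <;> split_ifs <;> simp <;> omega

variable {F : Type*}

/-- The labeled seed with cluster `X_n`, `X_{n+1}`; both families of frozen rows carry the same
`c`-vectors. -/
def chainSeed (X : ℤ → F) (φ : Fin 2 ⊕ Fin 2 → F) (n : ℤ) : Seed (Fin 2) (Fin 2 ⊕ Fin 2) F where
  var := Sum.elim (fun i => if i = position n then X n else X (n + 1)) φ
  mat := Matrix.of fun i j => Sum.elim
    (fun i => if i = j then 0 else if j = position n then -2 else 2)
    (fun r => if j = position n then cVecFst n (Sum.elim id id r) else cVecSnd n (Sum.elim id id r))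
    i

theorem mutateMatrix_chainSeed_fst (X : ℤ → F) (φ : Fin 2 ⊕ Fin 2 → F) (n : ℤ) :
    mutateMatrix (position n) (chainSeed X φ n).mat = (chainSeed X φ (n + 1)).mat := by
  rcases position_cases n with ⟨h1, h2⟩ | ⟨h1, h2⟩ <;>
  · ext (i | r) j
    · fin_cases i <;> fin_cases j <;> simp [mutateMatrix, chainSeed, h1, h2]
    · fin_cases j <;>
        simp [mutateMatrix, chainSeed, h1, h2, cVecSnd_add_one, cVecFst_add_one]

theorem mutateMatrix_chainSeed_snd (X : ℤ → F) (φ : Fin 2 ⊕ Fin 2 → F) (n : ℤ) :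
    mutateMatrix (position (n + 1 + 1)) (chainSeed X φ (n + 1)).mat = (chainSeed X φ n).mat := by
  have h3 : position (n + 1 + 1) = position n := by
    simp [position]
  rcases position_cases n with ⟨h1, h2⟩ | ⟨h1, h2⟩ <;>
  · ext (i | r) j
    · fin_cases i <;> fin_cases j <;> simp [mutateMatrix, chainSeed, h1, h2, h3]
    · fin_cases j <;>
        simp [mutateMatrix, chainSeed, h1, h2, h3, cVecSnd_add_one, cVecFst_add_one]

variable [Field F] {X : ℤ → F} {φ : Fin 2 ⊕ Fin 2 → F} {u v : F}

theorem mutate_chainSeed_fst (hu : u = φ (Sum.inl 0) * φ (Sum.inr 0))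
    (hv : v = φ (Sum.inl 1) * φ (Sum.inr 1)) {n : ℤ} (h0 : X n ≠ 0)
    (h : X (n + 1 + 1) * X n =
      u ^ (cVecFst n 0).toNat * v ^ (cVecFst n 1).toNat +
      u ^ (-cVecFst n 0).toNat * v ^ (-cVecFst n 1).toNat * X (n + 1) ^ 2) :
    (chainSeed X φ n).mutate (position n) = chainSeed X φ (n + 1) := by
  have hm := mutateMatrix_chainSeed_fst X φ n
  have hx := eq_div_of_mul_eq h0 h
  unfold Seed.mutate
  rw [hm]
  congr 1
  ext (i | r)
  · rcases position_cases n with ⟨h1, h2⟩ | ⟨h1, h2⟩ <;> fin_cases i <;>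
      simp [chainSeed, h1, h2, Fintype.prod_sum_type, Fin.prod_univ_two, hx, hu, hv] <;> ring
  · simp [chainSeed]

theorem mutate_chainSeed_snd (hu : u = φ (Sum.inl 0) * φ (Sum.inr 0))
    (hv : v = φ (Sum.inl 1) * φ (Sum.inr 1)) {n : ℤ} (h0 : X (n + 1 + 1) ≠ 0)
    (h : X n * X (n + 1 + 1) =
      u ^ (cVecSnd (n + 1) 0).toNat * v ^ (cVecSnd (n + 1) 1).toNat * X (n + 1) ^ 2 +
      u ^ (-cVecSnd (n + 1) 0).toNat * v ^ (-cVecSnd (n + 1) 1).toNat) :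
    (chainSeed X φ (n + 1)).mutate (position (n + 1 + 1)) = chainSeed X φ n := by
  have hm := mutateMatrix_chainSeed_snd X φ n
  have hx := eq_div_of_mul_eq h0 h
  have h3 : position (n + 1 + 1) = position n := by
    simp [position]
  unfold Seed.mutate
  rw [hm]
  congr 1
  ext (i | r)
  · rcases position_cases n with ⟨h1, h2⟩ | ⟨h1, h2⟩ <;> fin_cases i <;>
      simp [chainSeed, h1, h2, h3, Fintype.prod_sum_type, Fin.prod_univ_two, hx, hu, hv] <;> ring
  · simp [chainSeed]

end Seeds

/-! ### Cluster variables and cluster monomials -/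

section ClusterMonomials

/-- The factor relating the cluster variable `X_n` to the term `Y_n` of the two-sided linear
recurrence: the coefficients in the exchange relations force it to be nontrivial for `n ≤ 0`. -/
def scale {G : Type*} [DivInvMonoid G] (u v : G) (n : ℤ) : G :=
  if 1 ≤ n then 1 else u ^ (-n) * v ^ (1 - n)

variable {F : Type*} [Field F] {u v : F}

/-- The exchange relations hold for the rescaled sequence. -/
theorem exchange_scale_mul (hu : u ≠ 0) (hv : v ≠ 0) {Y : ℤ → F}
    (hY : ∀ n, Y (n + 1 + 1) * Y n = Y (n + 1) ^ 2 + u ^ n * v ^ (n - 1)) (n : ℤ) :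
    scale u v (n + 1 + 1) * Y (n + 1 + 1) * (scale u v n * Y n) =
      u ^ (cVecFst n 0).toNat * v ^ (cVecFst n 1).toNat +
      u ^ (-cVecFst n 0).toNat * v ^ (-cVecFst n 1).toNat *
        (scale u v (n + 1) * Y (n + 1)) ^ 2 := by
  have hnn : ∀ (w : F) (m : ℤ), 0 ≤ m → w ^ m.toNat = w ^ m := fun w m hm => by
    rw [← zpow_natCast, Int.toNat_of_nonneg hm]
  have hprod : scale u v (n + 1 + 1) * Y (n + 1 + 1) * (scale u v n * Y n) =
      scale u v (n + 1 + 1) * scale u v n * (Y (n + 1) ^ 2 + u ^ n * v ^ (n - 1)) := by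
    rw [← hY]; ring
  rw [hprod]
  rcases lt_trichotomy n 0 with hn | rfl | hn
  · obtain rfl | hn' : n = -1 ∨ n ≤ -2 := by omega
    · simp [scale, cVecFst]
      field_simp
      ring
    · have e0 : ¬ 1 ≤ n := by omega
      have e1 : ¬ 1 ≤ n + 1 := by omega
      have e2 : ¬ 1 ≤ n + 1 + 1 := by omega
      have e3 : n ≠ 0 := by omega
      have e4 : (-(-n - 2)).toNat = 0 := by omega
      have e5 : (-(-n - 1)).toNat = 0 := by omega
      simp only [scale, cVecFst, e0, e1, e2, e3, if_false, Matrix.cons_val_zero,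
        Matrix.cons_val_one, Matrix.cons_val_fin_one, e4, e5, pow_zero, mul_one, one_mul]
      rw [hnn _ _ (by omega), hnn _ _ (by omega)]
      simp only [neg_add, zpow_add₀ hu, zpow_add₀ hv, zpow_neg, sub_eq_add_neg, zpow_one]
      field_simp
      ring
  · simp [scale, cVecFst]
    field_simp
    ring
  · have e0 : 1 ≤ n := by omega
    have e1 : 1 ≤ n + 1 := by omega
    have e2 : 1 ≤ n + 1 + 1 := by omega
    have e4 : (-n).toNat = 0 := by omega
    have e5 : (-(n - 1)).toNat = 0 := by omega
    simp only [scale, cVecFst, e0, e1, e2, if_true, Matrix.cons_val_zero,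
      Matrix.cons_val_one, Matrix.cons_val_fin_one, e4, e5, pow_zero, mul_one, one_mul]
    rw [hnn _ _ (by omega), hnn _ _ (by omega)]
    ring

variable {X : ℤ → F} {φ : Fin 2 ⊕ Fin 2 → F}

/-- The seeds mutation equivalent to a seed of the chain are exactly the seeds of the chain. -/
theorem mutationEquiv_chainSeed_iff (hu : u = φ (Sum.inl 0) * φ (Sum.inr 0))
    (hv : v = φ (Sum.inl 1) * φ (Sum.inr 1)) (h0 : ∀ n, X n ≠ 0)
    (h : ∀ n, X (n + 1 + 1) * X n =
      u ^ (cVecFst n 0).toNat * v ^ (cVecFst n 1).toNat +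
      u ^ (-cVecFst n 0).toNat * v ^ (-cVecFst n 1).toNat * X (n + 1) ^ 2)
    (m : ℤ) (t : Seed (Fin 2) (Fin 2 ⊕ Fin 2) F) :
    (chainSeed X φ m).MutationEquiv t ↔ ∃ n, t = chainSeed X φ n := by
  have hfst : ∀ n, (chainSeed X φ n).mutate (position n) = chainSeed X φ (n + 1) :=
    fun n => mutate_chainSeed_fst hu hv (h0 n) (h n)
  have hsnd : ∀ n, (chainSeed X φ n).mutate (position (n + 1)) = chainSeed X φ (n - 1) :=
    fun n => by
      obtain ⟨n, rfl⟩ : ∃ k, n = k + 1 := ⟨n - 1, by ring⟩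
      rw [add_sub_cancel_right]
      refine mutate_chainSeed_snd hu hv (h0 _) ?_
      rw [mul_comm, h, cVecSnd_add_one, cVecSnd_add_one, neg_neg, neg_neg, add_comm]
  constructor
  · intro hmt
    induction hmt with
    | refl => exact ⟨m, rfl⟩
    | tail _ hstep ih =>
      obtain ⟨n, rfl⟩ := ih
      obtain ⟨k, rfl⟩ := hstep
      obtain rfl | rfl : k = position n ∨ k = position (n + 1) := by
        rcases position_cases n with ⟨h1, h2⟩ | ⟨h1, h2⟩ <;> rw [h1, h2] <;> fin_cases k <;> simp
      · exact ⟨n + 1, hfst n⟩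
      · exact ⟨n - 1, hsnd n⟩
  · rintro ⟨n, rfl⟩
    induction n using Int.inductionOn' (b := m) with
    | zero => exact Relation.ReflTransGen.refl
    | succ k _ ih => exact ih.tail ⟨_, (hfst k).symm⟩
    | pred k _ ih => exact ih.tail ⟨_, (hsnd k).symm⟩

theorem clusterVariables_chainSeed {m : ℤ}
    (h : ∀ t, (chainSeed X φ m).MutationEquiv t ↔ ∃ n, t = chainSeed X φ n) :
    (chainSeed X φ m).clusterVariables = Set.range X := by
  ext f
  simp only [Seed.clusterVariables, h, Set.mem_ofPred_eq, Set.mem_range]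
  constructor
  · rintro ⟨_, ⟨n, rfl⟩, i, rfl⟩
    by_cases hi : i = position n
    · exact ⟨n, by simp [chainSeed, hi]⟩
    · exact ⟨n + 1, by simp [chainSeed, hi]⟩
  · rintro ⟨n, rfl⟩
    exact ⟨_, ⟨n, rfl⟩, position n, by simp [chainSeed]⟩

theorem clusterMonomials_chainSeed {m : ℤ}
    (h : ∀ t, (chainSeed X φ m).MutationEquiv t ↔ ∃ n, t = chainSeed X φ n) :
    (chainSeed X φ m).clusterMonomials =
      {f | ∃ (k : ℤ) (a b : ℕ), f = X k ^ a * X (k + 1) ^ b} := by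
  have hprod : ∀ n (e : Fin 2 → ℕ), ∏ i, (chainSeed X φ n).var (Sum.inl i) ^ e i =
      X n ^ e (position n) * X (n + 1) ^ e (position (n + 1)) := fun n e => by
    rcases position_cases n with ⟨h1, h2⟩ | ⟨h1, h2⟩ <;>
      simp [Fin.prod_univ_two, chainSeed, h1, h2, mul_comm]
  ext f
  simp only [Seed.clusterMonomials, h, Set.mem_ofPred_eq]
  constructor
  · rintro ⟨_, ⟨n, rfl⟩, e, rfl⟩
    exact ⟨n, _, _, hprod n e⟩
  · rintro ⟨k, a, b, rfl⟩
    refine ⟨_, ⟨k, rfl⟩, fun i => if i = position k then a else b, ?_⟩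
    rw [hprod]
    rcases position_cases k with ⟨h1, h2⟩ | ⟨h1, h2⟩ <;> simp [h1, h2]

end ClusterMonomials

/-! ### The imaginary elements -/

section Imaginary

variable {𝕜 : Type*} [Field 𝕜] {n : ℕ}

theorem sumS_zero (a : Fin n → 𝕜ˣ) : sumS a 0 = 1 := by
  simp [sumS, Finset.powersetCard_zero, Finset.filter_singleton]

theorem sumS_eq_zero (a : Fin n → 𝕜ˣ) {r : ℕ} (h : n < 2 * r) : sumS a r = 0 := by
  rw [sumS, Finset.sum_eq_zero]
  rintro ⟨I, J⟩ hp
  simp only [Finset.mem_filter, Finset.mem_product, Finset.mem_powersetCard] at hp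
  have h1 := Finset.card_union_of_disjoint hp.2
  have h2 := Finset.card_le_univ (I ∪ J)
  rw [Fintype.card_fin] at h2
  omega

/-- For fixed `r`, the double sum over `m`, `k` in the numerator is a product of a monomial and a
power of `x₂² + u x₁² v + u`, by two applications of the binomial theorem. -/
theorem sum_choose_mul_choose {F : Type*} [CommRing F] (u v s t : F) {r : ℕ} (h : 2 * r ≤ n) :
    ∑ m ∈ Finset.Ico r (n + 1), ∑ k ∈ Finset.range (m + 1),
      (((m - r).choose k : F) * ((n - 2 * r).choose (m - r) : F)) *
        (u ^ m * v ^ (m - k) * s ^ (m - k) * t ^ (n - m)) =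
      (u * v * s * t) ^ r * (t + u * (v * s + 1)) ^ (n - 2 * r) := by
  have hinner : ∀ m', ∑ k ∈ Finset.range (r + m' + 1), ((m'.choose k : F) * (v * s) ^ (r + m' - k)) =
      (v * s) ^ r * (1 + v * s) ^ m' := fun m' => by
    rw [add_pow, Finset.mul_sum]
    have hsub : Finset.range (m' + 1) ⊆ Finset.range (r + m' + 1) :=
      Finset.range_mono (by omega)
    rw [← Finset.sum_subset hsub]
    · refine Finset.sum_congr rfl fun k hk => ?_
      rw [Finset.mem_range] at hk
      rw [show r + m' - k = r + (m' - k) by omega, pow_add, one_pow]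
      ring
    · intro k _ hk
      rw [Finset.mem_range, not_lt] at hk
      rw [Nat.choose_eq_zero_of_lt (by omega)]
      simp
  have hpow : (t + u * (v * s + 1)) ^ (n - 2 * r) = (u * (1 + v * s) + t) ^ (n - 2 * r) := by ring
  rw [hpow, add_pow, Finset.mul_sum, Finset.sum_Ico_eq_sum_range]
  have hsub : Finset.range (n - 2 * r + 1) ⊆ Finset.range (n + 1 - r) :=
    Finset.range_mono (by omega)
  rw [← Finset.sum_subset hsub]
  · refine Finset.sum_congr rfl fun m' hm => ?_
    rw [Finset.mem_range] at hm
    have h2 : ∀ k, (((r + m' - r).choose k : F) * ((n - 2 * r).choose (r + m' - r) : F)) *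
        (u ^ (r + m') * v ^ (r + m' - k) * s ^ (r + m' - k) * t ^ (n - (r + m'))) =
        ((n - 2 * r).choose m' : F) * u ^ (r + m') * t ^ (n - (r + m')) *
          ((m'.choose k : F) * (v * s) ^ (r + m' - k)) := fun k => by
      rw [Nat.add_sub_cancel_left, mul_pow]; ring
    rw [Finset.sum_congr rfl fun k _ => h2 k, ← Finset.mul_sum, hinner,
      show n - (r + m') = r + (n - 2 * r - m') by omega]
    simp only [pow_add, mul_pow]
    ring
  · intro m' _ hm'
    rw [Finset.mem_range, not_lt] at hm'
    refine Finset.sum_eq_zero fun k _ => ?_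
    rw [Nat.add_sub_cancel_left, Nat.choose_eq_zero_of_lt (show n - 2 * r < m' by omega)]
    simp

/-- The double sum defining the imaginary element, with the sum over `r` inside `coeffD` pulled to
the front. The terms with `2 * r > n`, where `n - 2 * r` is truncated, vanish. -/
theorem sum_coeffD_mul {F : Type*} [Field F] [Algebra 𝕜 F] (a : Fin n → 𝕜ˣ) {u v x₁ x₂ : F}
    (h₁ : x₁ ≠ 0) (h₂ : x₂ ≠ 0) :
    (x₁ ^ n)⁻¹ * (x₂ ^ n)⁻¹ * ∑ m ∈ Finset.range (n + 1), ∑ k ∈ Finset.range (m + 1),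
      algebraMap 𝕜 F (coeffD a m k) *
        (u ^ m * v ^ (m - k) * (x₁ ^ 2) ^ (m - k) * (x₂ ^ 2) ^ (n - m)) =
    ∑ r ∈ Finset.range (n + 1), algebraMap 𝕜 F (sumS a r) * (u * v) ^ r *
      ((x₂ ^ 2 + u * (v * x₁ ^ 2 + 1)) / (x₁ * x₂)) ^ (n - 2 * r) := by
  have hswap : ∑ m ∈ Finset.range (n + 1), ∑ k ∈ Finset.range (m + 1),
      algebraMap 𝕜 F (coeffD a m k) *
        (u ^ m * v ^ (m - k) * (x₁ ^ 2) ^ (m - k) * (x₂ ^ 2) ^ (n - m)) =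
      ∑ r ∈ Finset.range (n + 1), algebraMap 𝕜 F (sumS a r) *
        ∑ m ∈ Finset.Ico r (n + 1), ∑ k ∈ Finset.range (m + 1),
          (((m - r).choose k : F) * ((n - 2 * r).choose (m - r) : F)) *
            (u ^ m * v ^ (m - k) * (x₁ ^ 2) ^ (m - k) * (x₂ ^ 2) ^ (n - m)) := by
    simp only [Finset.mul_sum]
    have hcomm : ∀ G : ℕ → ℕ → F, ∑ m ∈ Finset.range (n + 1), ∑ r ∈ Finset.range (m + 1), G m r =
        ∑ r ∈ Finset.range (n + 1), ∑ m ∈ Finset.Ico r (n + 1), G m r := fun G => by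
      refine Finset.sum_comm' fun m r => ?_
      simp only [Finset.mem_range, Finset.mem_Ico]
      omega
    rw [← hcomm]
    refine Finset.sum_congr rfl fun m _ => ?_
    rw [Finset.sum_comm]
    refine Finset.sum_congr rfl fun k _ => ?_
    rw [coeffD, map_sum, Finset.sum_mul]
    refine Finset.sum_congr rfl fun r _ => ?_
    simp only [map_mul, map_natCast]
    ring
  rw [hswap, Finset.mul_sum]
  refine Finset.sum_congr rfl fun r _ => ?_
  rcases lt_or_ge n (2 * r) with hr | hr
  · simp [sumS_eq_zero a hr]
  · rw [sum_choose_mul_choose _ _ _ _ hr]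
    have hn : n = 2 * r + (n - 2 * r) := by omega
    have hx : (x₁ ^ n)⁻¹ * (x₂ ^ n)⁻¹ = ((x₁ ^ 2 * x₂ ^ 2) ^ r)⁻¹ * ((x₁ * x₂) ^ (n - 2 * r))⁻¹ := by
      rw [← mul_inv, ← mul_inv, ← mul_pow, ← mul_pow (x₁), ← pow_mul, ← pow_add, ← hn]
    rw [hx, div_pow]
    have hr0 : (x₁ ^ 2 * x₂ ^ 2) ^ r ≠ 0 := by positivity
    field_simp
    simp only [mul_pow]
    ring

end Imaginary

/-! ### The basis -/

section Basis

variable {R F : Type*} [CommRing R] [Field F] [Algebra R F] {x₁ x₂ z : F}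

/-- A polynomial in `z` with leading term `z ^ n` has the leading monomial of `z ^ n`. The truncated
exponents `n - 2 * r` do no harm, since they are smaller than `n` for `r ≥ 1`. -/
theorem hasLead_sum_smul_pow (h₁ : x₁ ≠ 0) (h₂ : x₂ ≠ 0)
    (hz : HasLead R (laurentMonomial x₁ x₂) (toLex (0, 1)) z) {n : ℕ} {c : ℕ → R} (hc : c 0 = 1) :
    HasLead R (laurentMonomial x₁ x₂) (toLex (0, (n : ℤ)))
      (∑ r ∈ Finset.range (n + 1), c r • z ^ (n - 2 * r)) := by
  have hpow : ∀ m : ℕ, HasLead R (laurentMonomial x₁ x₂) (toLex (0, (m : ℤ))) (z ^ m) := fun m => by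
    have h := hz.pow (laurentMonomial_add h₁ h₂) laurentMonomial_zero m
    have h3 : m • toLex ((0 : ℤ), (1 : ℤ)) = toLex (0, (m : ℤ)) := by
      change toLex (m • ((0 : ℤ), (1 : ℤ))) = _
      simp
    rwa [h3] at h
  unfold HasLead
  rw [Finset.sum_range_succ', hc, one_smul, mul_zero, Nat.sub_zero, add_sub_assoc]
  refine add_mem (Submodule.sum_mem _ fun r hr => Submodule.smul_mem _ _ ?_) (hpow n)
  refine (hpow _).mem_span_Iio ?_
  rw [Finset.mem_range] at hr
  rw [Prod.Lex.toLex_lt_toLex]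
  right
  simp only [true_and]
  omega

/-- Monic polynomials in `z` of all degrees span the powers of `z`, by unitriangularity. -/
theorem pow_mem_span_range {P : ℕ → F}
    (hP : ∀ n, ∃ c : ℕ → R, c 0 = 1 ∧ P n = ∑ r ∈ Finset.range (n + 1), c r • z ^ (n - 2 * r))
    (n : ℕ) : z ^ n ∈ Submodule.span R (Set.range P) := by
  induction n using Nat.strong_induction_on with
  | _ n ih =>
    obtain ⟨c, hc, hPn⟩ := hP n
    rw [Finset.sum_range_succ', hc, one_smul, mul_zero, Nat.sub_zero] at hPn
    rw [← sub_eq_iff_eq_add'] at hPn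
    rw [← hPn]
    refine sub_mem (Submodule.subset_span ⟨n, rfl⟩) (Submodule.sum_mem _ fun r hr =>
      Submodule.smul_mem _ _ (ih _ ?_))
    rw [Finset.mem_range] at hr
    omega

theorem exists_units_smul_monomial {Y X : ℤ → F} (w : ℤ → Rˣ)
    (hX : ∀ n, X n = (w n : R) • Y n) (k l : ℤ) (a b : ℕ) :
    X k ^ a * X l ^ b = ((w k ^ a * w l ^ b : Rˣ) : R) • (Y k ^ a * Y l ^ b) := by
  simp only [hX, Algebra.smul_def, Units.val_mul, Units.val_pow_eq_pow_val, map_mul, map_pow]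
  ring

/-- The basis theorem for the algebra generated by unit multiples `X_n` of the terms of a sequence
satisfying a three-term recurrence: the monomials in two consecutive `X_n` together with one monic
polynomial in `z` of each positive degree form a basis. -/
theorem exists_basis_of_recurrence [Nontrivial R] (h₁ : x₁ ≠ 0) (h₂ : x₂ ≠ 0)
    (hB : LinearIndependent R (laurentMonomial x₁ x₂)) {p : Rˣ} {q : R}
    (hz : z = laurentMonomial x₁ x₂ (toLex (0, 1)) +
      (p : R) • laurentMonomial x₁ x₂ (toLex (0, -1)) +
      q • laurentMonomial x₁ x₂ (toLex (-2, -1)))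
    {Y : ℤ → F} (hY1 : Y 1 = x₁) (hY2 : Y 2 = x₂)
    (hY : ∀ n, Y (n + 1) = z * Y n - (p : R) • Y (n - 1)) {κ : ℤ → Rˣ}
    (hκ : ∀ n, Y (n + 1) * Y (n - 1) = Y n ^ 2 + algebraMap R F (κ n)) {w : ℤ → Rˣ} {X : ℤ → F}
    (hX : ∀ n, X n = (w n : R) • Y n) {P : ℕ → F}
    (hP : ∀ n, ∃ c : ℕ → R, c 0 = 1 ∧ P n = ∑ r ∈ Finset.range (n + 1), c r • z ^ (n - 2 * r))
    {C : Set F} (hC : C = {f | ∃ (k : ℤ) (a b : ℕ), f = X k ^ a * X (k + 1) ^ b})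
    {A : Subalgebra R F} (hA : A = Algebra.adjoin R (Set.range X)) :
    ∃ b : Module.Basis (C ⊕ ℕ+) R A, (∀ m : C, (b (Sum.inl m) : F) = m) ∧
      ∀ n : ℕ+, (b (Sum.inr n) : F) = P n := by
  have hzlead : HasLead R (laurentMonomial x₁ x₂) (toLex (0, 1)) z := by
    unfold HasLead
    rw [hz, add_assoc, add_sub_cancel_left]
    refine add_mem (Submodule.smul_mem _ _ ?_) (Submodule.smul_mem _ _ ?_) <;>
      refine Submodule.subset_span ⟨_, ?_, rfl⟩ <;>
      simp [Prod.Lex.toLex_lt_toLex]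
  have hYlead := hasLead_of_recurrence h₁ h₂ p q hz hY1 hY2 hY
  have hPlead : ∀ n : ℕ, HasLead R (laurentMonomial x₁ x₂) (toLex (0, (n : ℤ))) (P n) := fun n => by
    obtain ⟨c, hc, hPn⟩ := hP n
    rw [hPn]
    exact hasLead_sum_smul_pow h₁ h₂ hzlead hc
  have hliX : LinearIndependent R (Sum.elim P (consecutiveMonomial X)) := by
    have h := (linearIndependent_sumElim_consecutiveMonomial h₁ h₂ hB hYlead hPlead).units_smul
      (Sum.elim (fun _ => 1) fun q : ℕ+ × ℤ => w (q.2 / q.1 + 1) ^ ((q.1 : ℤ) - q.2 % q.1).toNat *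
        w (q.2 / q.1 + 1 + 1) ^ (q.2 % q.1).toNat)
    convert h using 1
    ext (n | q)
    · simp
    · exact exists_units_smul_monomial w hX _ _ _ _
  have hP0 : P 0 = 1 := by
    obtain ⟨c, hc, hPn⟩ := hP 0
    simpa [hc] using hPn
  set f : C ⊕ ℕ+ → F := Sum.elim (fun m => (m : F)) fun n => P n with hf
  -- every cluster monomial other than `1 = P 0` is listed by `consecutiveMonomial X`
  have hidx : ∀ m : C, ∃ i : ℕ ⊕ (ℕ+ × ℤ), (i = Sum.inl 0 ∨ ∃ q, i = Sum.inr q) ∧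
      Sum.elim P (consecutiveMonomial X) i = m := by
    rintro ⟨m, hm⟩
    rw [hC] at hm
    obtain ⟨k, a, b, rfl⟩ := hm
    by_cases hab : a + b = 0
    · obtain ⟨rfl, rfl⟩ : a = 0 ∧ b = 0 := by omega
      exact ⟨Sum.inl 0, Or.inl rfl, by simp [hP0]⟩
    · obtain ⟨q, hq⟩ := exists_consecutiveMonomial_eq X k a b hab
      exact ⟨Sum.inr q, Or.inr ⟨q, rfl⟩, hq⟩
  choose idx hidx1 hidx2 using hidx
  have hfli : LinearIndependent R f := by
    have h : f = Sum.elim P (consecutiveMonomial X) ∘ Sum.elim idx fun n : ℕ+ => Sum.inl (n : ℕ) := by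
      ext (m | n)
      · exact (hidx2 m).symm
      · rfl
    rw [h]
    refine hliX.comp _ ?_
    have hne : ∀ (m : C) (n : ℕ+), idx m ≠ Sum.inl (n : ℕ) := fun m n hmn => by
      rcases hidx1 m with h0 | ⟨q, hq⟩
      · rw [h0] at hmn
        exact n.ne_zero (Sum.inl_injective hmn).symm
      · rw [hq] at hmn
        exact absurd hmn (by simp)
    rintro (m | n) (m' | n') hmn <;> simp only [Sum.elim_inl, Sum.elim_inr] at hmn
    · rw [Subtype.ext ((hidx2 m).symm.trans ((congrArg _ hmn).trans (hidx2 m')))]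
    · exact absurd hmn (hne m n')
    · exact absurd hmn.symm (hne m' n)
    · rw [PNat.coe_injective (Sum.inl_injective hmn)]
  have hwY : ∀ (c : Rˣ) (g : F), g = ((c⁻¹ : Rˣ) : R) • (c : R) • g := fun c g => by
    rw [smul_smul, Units.inv_mul, one_smul]
  have hXA : ∀ n, X n ∈ A := fun n => hA ▸ Algebra.subset_adjoin ⟨n, rfl⟩
  have hYA : ∀ n, Y n ∈ A := fun n => by
    rw [hwY (w n) (Y n), ← hX]
    exact A.smul_mem (hXA n) _
  have hzA : z ∈ A := by
    -- recurrence and Cassini relation give `Y 3 * Y 0 = Y 1 * Y 2 + κ 1 * z`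
    have h : z = (((κ 1)⁻¹ : Rˣ) : R) • (Y 3 * Y 0 - Y 1 * Y 2) := by
      rw [hwY (κ 1) z]
      congr 1
      have e1 := hY 1
      have e2 := hY 2
      have e3 := hκ 1
      norm_num at e1 e2 e3
      simp only [Algebra.smul_def] at e1 e2 ⊢
      rw [e2]
      linear_combination (-z) * e3 + Y 1 * e1
    rw [h]
    exact A.smul_mem (sub_mem (mul_mem (hYA _) (hYA _)) (mul_mem (hYA _) (hYA _))) _
  have hfA : ∀ i, f i ∈ A := by
    rintro (⟨m, hm⟩ | n)
    · rw [hC] at hm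
      obtain ⟨k, a, b, rfl⟩ := hm
      exact mul_mem (pow_mem (hXA _) _) (pow_mem (hXA _) _)
    · obtain ⟨c, -, hPn⟩ := hP n
      simp only [hf, Sum.elim_inr]
      rw [hPn]
      exact sum_mem fun r _ => A.smul_mem (pow_mem hzA _) _
  have hspan : ∀ g ∈ A, g ∈ Submodule.span R (Set.range f) := by
    intro g hg
    rw [hA] at hg
    have hg' : g ∈ standardSpan R Y z := adjoin_le_standardSpan hY (κ := fun n => (κ n : R)) hκ
      (by rintro _ ⟨n, rfl⟩; exact ⟨_, n, hX n⟩) hg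
    refine Submodule.span_le.2 ?_ hg'
    rintro _ (⟨k, a, b, rfl⟩ | ⟨n, rfl⟩)
    · rw [hwY (w k ^ a * w (k + 1) ^ b) (_ * _), ← exists_units_smul_monomial w hX]
      refine Submodule.smul_mem _ _ (Submodule.subset_span ⟨Sum.inl ⟨_, ?_⟩, rfl⟩)
      rw [hC]
      exact ⟨k, a, b, rfl⟩
    · refine Submodule.span_mono ?_ (pow_mem_span_range hP n)
      rintro _ ⟨m, rfl⟩
      rcases Nat.eq_zero_or_pos m with rfl | hm
      · refine ⟨Sum.inl ⟨1, ?_⟩, hP0.symm⟩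
        rw [hC]
        exact ⟨0, 0, 0, by simp⟩
      · exact ⟨Sum.inr ⟨m, hm⟩, rfl⟩
  have hrange : A.val ∘ (fun i => (⟨f i, hfA i⟩ : A)) = f := rfl
  refine ⟨Module.Basis.mk (v := fun i => (⟨f i, hfA i⟩ : A))
    (LinearIndependent.of_comp A.val.toLinearMap hfli) ?_, fun m => ?_, fun n => ?_⟩
  · rintro ⟨g, hg⟩ -
    have h := hspan g hg
    rw [← hrange, Set.range_comp, ← AlgHom.coe_toLinearMap, Submodule.span_image] at h
    obtain ⟨g', hg', rfl⟩ := h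
    exact hg'
  · rw [Module.Basis.mk_apply]
    rfl
  · rw [Module.Basis.mk_apply]
    rfl

end Basis

/-! ### The seed of type A₁⁽¹⁾ -/

theorem seedA11_eq_chainSeed (𝕜 : Type*) [Field 𝕜] {X : ℤ → AmbientField 𝕜 2}
    (h1 : X 1 = (seedA11 𝕜).var (Sum.inl 0)) (h2 : X 2 = (seedA11 𝕜).var (Sum.inl 1)) :
    seedA11 𝕜 = chainSeed X (fun j => (seedA11 𝕜).var (Sum.inr j)) 1 := by
  have hp : position 1 = 0 := by simp [position]
  have hvar : (seedA11 𝕜).var =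
      (chainSeed X (fun j => (seedA11 𝕜).var (Sum.inr j)) 1).var := by
    ext (i | j)
    · fin_cases i <;> simp [chainSeed, hp, h1, h2]
    · simp [chainSeed]
  have hmat : (seedA11 𝕜).mat =
      (chainSeed X (fun j => (seedA11 𝕜).var (Sum.inr j)) 1).mat := by
    ext (i | i | i) j <;> fin_cases i <;> fin_cases j <;>
      simp [chainSeed, hp, dpSeed, coxeterExchangeMatrix, cartanA11, cVecFst, cVecSnd]
  exact congrArg₂ Seed.mk hvar hmat

theorem linearIndependent_laurentMonomial_seedA11 (𝕜 : Type*) [Field 𝕜] :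
    LinearIndependent ((seedA11 𝕜).groundRing 𝕜)
      (laurentMonomial ((seedA11 𝕜).var (Sum.inl 0)) ((seedA11 𝕜).var (Sum.inl 1))) := by
  have hind : AlgebraicIndependent 𝕜 (seedA11 𝕜).var :=
    (MvPolynomial.algebraicIndependent_X (Fin 2 ⊕ (Fin 2 ⊕ Fin 2)) 𝕜).map'
      (f := IsScalarTower.toAlgHom 𝕜 _ (AmbientField 𝕜 2))
      (IsFractionRing.injective (MvPolynomial (Fin 2 ⊕ (Fin 2 ⊕ Fin 2)) 𝕜) (AmbientField 𝕜 2))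
  have hsum : Sum.elim ![(seedA11 𝕜).var (Sum.inl 0), (seedA11 𝕜).var (Sum.inl 1)]
      (fun j => (seedA11 𝕜).var (Sum.inr j)) = (seedA11 𝕜).var := by
    ext (i | j)
    · fin_cases i <;> rfl
    · rfl
  rw [← hsum] at hind
  refine linearIndependent_laurentMonomial (linearIndependent_laurent_monomials_of_le hind ?_)
  refine Algebra.adjoin_le (Set.union_subset ?_ ?_)
  · rintro _ ⟨j, rfl⟩
    exact IntermediateField.subset_adjoin _ _ ⟨j, rfl⟩
  · rintro _ ⟨j, rfl⟩
    exact (IntermediateField.adjoin 𝕜 _).inv_mem (IntermediateField.subset_adjoin 𝕜 _ ⟨j, rfl⟩)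

/-- A frozen variable as a unit of the ground ring. -/
def frozenUnit {I J F : Type*} [Field F] (𝕜 : Type*) [Field 𝕜] [Algebra 𝕜 F] (s : Seed I J F)
    (j : J) (h : s.var (Sum.inr j) ≠ 0) : (s.groundRing 𝕜)ˣ where
  val := ⟨s.var (Sum.inr j), Algebra.subset_adjoin (Or.inl ⟨j, rfl⟩)⟩
  inv := ⟨(s.var (Sum.inr j))⁻¹, Algebra.subset_adjoin (Or.inr ⟨j, rfl⟩)⟩
  val_inv := Subtype.ext (mul_inv_cancel₀ h)
  inv_val := Subtype.ext (inv_mul_cancel₀ h)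

/-- The imaginary element is a polynomial in the element `z` (the case `n = 1`) of degree `n` with leading
coefficient `1`; its lower coefficients are `S_{a,r} * (u * v) ^ r`. -/
theorem imaginaryElement_eq {𝕜 : Type*} [Field 𝕜] {n : ℕ} (a : Fin n → 𝕜ˣ)
    {x₁ x₂ u v : AmbientField 𝕜 2} (hx₁ : x₁ = (seedA11 𝕜).var (Sum.inl 0))
    (hx₂ : x₂ = (seedA11 𝕜).var (Sum.inl 1))
    (hu : u = (seedA11 𝕜).var (Sum.inr (Sum.inl 0)) * (seedA11 𝕜).var (Sum.inr (Sum.inr 0)))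
    (hv : v = (seedA11 𝕜).var (Sum.inr (Sum.inl 1)) * (seedA11 𝕜).var (Sum.inr (Sum.inr 1)))
    (h₁ : x₁ ≠ 0) (h₂ : x₂ ≠ 0) :
    imaginaryElement a = ∑ r ∈ Finset.range (n + 1), algebraMap 𝕜 _ (sumS a r) * (u * v) ^ r *
      ((x₂ ^ 2 + u * (v * x₁ ^ 2 + 1)) / (x₁ * x₂)) ^ (n - 2 * r) := by
  rw [← sum_coeffD_mul a h₁ h₂, imaginaryElement, hx₁, hx₂, hu, hv]
  congr 1
  refine Finset.sum_congr rfl fun m _ => Finset.sum_congr rfl fun k _ => ?_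
  congr 1
  simp only [← pow_mul, mul_pow]
  ring

end ClusterBasis

open ClusterBasis in
theorem mainTheorem6 (𝕜 : Type*) [Field 𝕜] [IsAlgClosed 𝕜] [CharZero 𝕜]
    (a : ∀ n : ℕ+, Fin n → 𝕜ˣ) :
    ∃ b : Module.Basis ((ClusterBasis.seedA11 𝕜).clusterMonomials ⊕ ℕ+)
        ((ClusterBasis.seedA11 𝕜).groundRing 𝕜) ((ClusterBasis.seedA11 𝕜).clusterAlgebra 𝕜),
      (∀ m : (ClusterBasis.seedA11 𝕜).clusterMonomials,
        (b (Sum.inl m) : ClusterBasis.AmbientField 𝕜 2) = m) ∧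
      (∀ n : ℕ+, (b (Sum.inr n) : ClusterBasis.AmbientField 𝕜 2) =
        ClusterBasis.imaginaryElement (a n)) := by
  have hne : ∀ i, (seedA11 𝕜).var i ≠ 0 := fun i =>
    (map_ne_zero_iff _ (IsFractionRing.injective (MvPolynomial (Fin 2 ⊕ (Fin 2 ⊕ Fin 2)) 𝕜)
      (AmbientField 𝕜 2))).2 (MvPolynomial.X_ne_zero i)
  obtain ⟨x₁, hx₁⟩ : ∃ x, x = (seedA11 𝕜).var (Sum.inl 0) := ⟨_, rfl⟩
  obtain ⟨x₂, hx₂⟩ : ∃ x, x = (seedA11 𝕜).var (Sum.inl 1) := ⟨_, rfl⟩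
  have h₁ : x₁ ≠ 0 := hx₁ ▸ hne _
  have h₂ : x₂ ≠ 0 := hx₂ ▸ hne _
  have hB := linearIndependent_laurentMonomial_seedA11 𝕜
  rw [← hx₁, ← hx₂] at hB
  set R := (seedA11 𝕜).groundRing 𝕜
  -- the two copies of each principal coefficient occur in exchange relations only through products
  let U : Fin 2 → Rˣ := fun i => frozenUnit 𝕜 (seedA11 𝕜) (Sum.inl i) (hne _) *
    frozenUnit 𝕜 (seedA11 𝕜) (Sum.inr i) (hne _)
  have hU : ∀ i, algebraMap R (AmbientField 𝕜 2) (U i) =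
      (seedA11 𝕜).var (Sum.inr (Sum.inl i)) * (seedA11 𝕜).var (Sum.inr (Sum.inr i)) :=
    fun i => rfl
  obtain ⟨u, hu⟩ : ∃ u, u = algebraMap R (AmbientField 𝕜 2) (U 0) := ⟨_, rfl⟩
  obtain ⟨v, hv⟩ : ∃ v, v = algebraMap R (AmbientField 𝕜 2) (U 1) := ⟨_, rfl⟩
  have hu0 : u ≠ 0 := by rw [hu, hU]; exact mul_ne_zero (hne _) (hne _)
  have hv0 : v ≠ 0 := by rw [hv, hU]; exact mul_ne_zero (hne _) (hne _)
  have hzpow : ∀ (c : Rˣ) (m : ℤ), algebraMap R (AmbientField 𝕜 2) ((c ^ m : Rˣ) : R) =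
      (algebraMap R (AmbientField 𝕜 2) c) ^ m := fun c m => by
    have h := congrArg Units.val
      (map_zpow (Units.map (algebraMap R (AmbientField 𝕜 2)).toMonoidHom) c m)
    rwa [Units.val_zpow_eq_zpow_val] at h
  set z : AmbientField 𝕜 2 := (x₂ ^ 2 + u * (v * x₁ ^ 2 + 1)) / (x₁ * x₂) with hzdef
  obtain ⟨Y, hY1, hY2, hY⟩ := exists_recurrent_sequence z (u * v) x₁ x₂ (mul_ne_zero hu0 hv0)
  have hY0 : Y 2 * Y 0 = Y 1 ^ 2 + v⁻¹ := by
    have h := hY 1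
    norm_num at h
    rw [hY2, hY1, hzdef] at h
    rw [hY2, hY1]
    field_simp at h ⊢
    apply mul_left_cancel₀ hu0
    linear_combination h
  have hκF := mul_eq_sq_add_of_recurrence (mul_ne_zero hu0 hv0) hY hY0
  let κ : ℤ → Rˣ := fun n => (U 1) ^ (-1 : ℤ) * ((U 0) ^ (n - 1) * (U 1) ^ (n - 1))
  have hκ : ∀ n, Y (n + 1) * Y (n - 1) = Y n ^ 2 + algebraMap R (AmbientField 𝕜 2) (κ n) :=
    fun n => by
      simp only [κ, Units.val_mul, map_mul, hzpow, ← hu, ← hv]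
      rw [hκF, mul_zpow, zpow_neg_one]
  have hYY : ∀ n, Y (n + 1 + 1) * Y n = Y (n + 1) ^ 2 + u ^ n * v ^ (n - 1) := fun n => by
    have h := hκF (n + 1)
    rw [add_sub_cancel_right] at h
    rw [h, mul_zpow, zpow_sub_one₀ hv0]
    ring
  have hYR : ∀ n, Y (n + 1) = z * Y n - ((U 0 * U 1 : Rˣ) : R) • Y (n - 1) := fun n => by
    rw [hY, Algebra.smul_def, Units.val_mul, map_mul, ← hu, ← hv]
  have hz : z = laurentMonomial x₁ x₂ (toLex (0, 1)) +
      ((U 0 * U 1 : Rˣ) : R) • laurentMonomial x₁ x₂ (toLex (0, -1)) +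
      (U 0 : R) • laurentMonomial x₁ x₂ (toLex (-2, -1)) := by
    simp only [laurentMonomial, Algebra.smul_def, Units.val_mul, map_mul, ← hu, ← hv, ofLex_toLex,
      hzdef]
    norm_num
    field_simp
    ring
  -- the cluster variables, normalized as the exchange relations require
  let X : ℤ → AmbientField 𝕜 2 := fun n => scale u v n * Y n
  have hX : ∀ n, X n = ((scale (U 0) (U 1) n : Rˣ) : R) • Y n := fun n => by
    simp only [X, scale, Algebra.smul_def]
    split_ifs
    · simp
    · rw [Units.val_mul, map_mul, hzpow, hzpow, ← hu, ← hv]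
  have hY_ne : ∀ n, Y n ≠ 0 := fun n => by
    exact (linearIndependent_of_triangular (ι := Unit) hB
      (g := fun _ => toLex (1, n - 1)) (fun _ _ _ => rfl) (f := fun _ => Y n)
      fun _ => hasLead_of_recurrence h₁ h₂ _ _ hz hY1 hY2 hYR n).ne_zero ()
  have hX_ne : ∀ n, X n ≠ 0 := fun n => by
    rw [hX, ← Units.smul_def]
    exact (smul_ne_zero_iff_ne _).2 (hY_ne n)
  have hseed : seedA11 𝕜 = chainSeed X (fun j => (seedA11 𝕜).var (Sum.inr j)) 1 :=
    seedA11_eq_chainSeed 𝕜 (by simp [X, scale, hY1, hx₁]) (by simp [X, scale, hY2, hx₂])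
  have hmut := mutationEquiv_chainSeed_iff (X := X) (φ := fun j => (seedA11 𝕜).var (Sum.inr j))
    (u := u) (v := v) (by rw [hu, hU]) (by rw [hv, hU]) hX_ne
    (exchange_scale_mul hu0 hv0 hYY) 1
  have hvars := clusterVariables_chainSeed hmut
  have hmons := clusterMonomials_chainSeed hmut
  rw [← hseed] at hvars hmons
  -- `P 0 = 1` is the cluster monomial that completes the imaginary elements to a unitriangular
  -- transform of the powers of `z`
  let P : ℕ → AmbientField 𝕜 2 := fun n => if h : 0 < n then imaginaryElement (a ⟨n, h⟩) else 1
  have hP : ∀ n, ∃ c : ℕ → R, c 0 = 1 ∧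
      P n = ∑ r ∈ Finset.range (n + 1), c r • z ^ (n - 2 * r) := fun n => by
    rcases Nat.eq_zero_or_pos n with rfl | hn
    · exact ⟨fun _ => 1, rfl, by simp [P]⟩
    · refine ⟨fun r => algebraMap 𝕜 R (sumS (a ⟨n, hn⟩) r) * ((U 0 * U 1 : Rˣ) : R) ^ r, ?_, ?_⟩
      · beta_reduce
        rw [sumS_zero, map_one, pow_zero, mul_one]
      · simp only [P, hn, dif_pos]
        rw [imaginaryElement_eq (a ⟨n, hn⟩) hx₁ hx₂ (hu.trans (hU 0)) (hv.trans (hU 1)) h₁ h₂]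
        refine Finset.sum_congr rfl fun r _ => ?_
        rw [Algebra.smul_def, map_mul, map_pow, Units.val_mul, map_mul, ← hu, ← hv,
          ← IsScalarTower.algebraMap_apply]
        rfl
  obtain ⟨b, hb1, hb2⟩ := exists_basis_of_recurrence h₁ h₂ hB hz hY1 hY2 hYR hκ hX hP hmons
    (A := (seedA11 𝕜).clusterAlgebra 𝕜) (congrArg (Algebra.adjoin R) hvars)
  refine ⟨b, hb1, fun n => (hb2 n).trans ?_⟩
  exact dif_pos n.pos
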